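/- Let $p_1 = 2 < p_2 = 3 < p_3 = 5 < \cdots$ be the sequence of all primes, and for $n \ge 1$ let $$\bar p_n = \frac1n \sum_{i=1}^n p_i$$ be the average of the first $n$ primes. (Prime-average analogue of Firoozbakht.) The sequence $\big((\bar p_n)^{1/n}\big)_{n \ge 1}$ is strictly decreasing. For each $n \ge 1$, the inequality $(\bar p_{n+1})^{1/(n+1)} < (\bar p_n)^{1/n}$ is equivalent to $$\left( \frac{\ln \bar p_{n+1}}{\ln \bar p_n} \right)^n < \left(1 + \frac1n\right)^n ,$$ so this inequality also holds for all $n \ge 1$. (Prime-average analogue of Fourges.) Consequently, for all $n \ge 1$, $$\left( \frac{\ln \bar p_{n+1}}{\ln \bar p_n} \right)^n < e .$$ -/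

import Mathlib

/-- The average `(p₁ + ⋯ + pₙ) / n` of the first `n` primes, as a real number.
`Nat.nth Nat.Prime` is indexed from `0`, so `Nat.nth Nat.Prime i` is the prime `p_{i+1}`
and the sum runs over `p₁, …, pₙ`. It is meant for `n ≥ 1`. -/
noncomputable def primeAvg (n : ℕ) : ℝ :=
  (∑ i ∈ Finset.range n, (Nat.nth Nat.Prime i : ℝ)) / (n : ℝ)

/-! Write `A` for the average of the first `n` primes. Monotonicity means `primeAvg (n + 1) ^ n < A
^ (n + 1)`. Appending `p_{n+1}` moves the average by `(p_{n+1} - A) / (n + 1)`, so `log t ≤ t - 1`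
reduces this to `p_{n+1} ≤ A (1 + log A)`. For `p_{n+1} ≥ 1024`, a mod-30 sieve makes `A` at least
linear in `n`, and Chebyshev's bound turns this into `A ≥ 1.2 x / log x` with `x = p_{n+1}`, which
suffices. Smaller primes are checked by computation. Taking logarithms gives the second form, and
`(1 + 1/n)^n < e` the third. -/

theorem Nat.nth_prime_add_thirty_le {i : ℕ} (hi : 3 ≤ i) :
    Nat.nth Nat.Prime i + 30 ≤ Nat.nth Nat.Prime (i + 8) := by
  rw [← Nat.count_le_iff_le_nth Nat.infinite_setOfPred_prime, Nat.count_add,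
    Nat.count_nth_of_infinite Nat.infinite_setOfPred_prime]
  have h7 : 7 ≤ Nat.nth Nat.Prime i := by
    rw [← Nat.count_le_iff_le_nth Nat.infinite_setOfPred_prime]
    exact le_trans (by norm_num [Nat.count_succ]) hi
  generalize Nat.nth Nat.Prime i = p at h7
  -- Primes from 7 on are coprime to 30, and 30 consecutive integers contain `φ(30) = 8` such
  -- residues.
  have h : Nat.count (fun k => Nat.Prime (p + k)) 30 ≤ 8 := by
    rw [Nat.count_eq_card_filter_range]
    have ht := Nat.filter_coprime_Ico_eq_totient 30 p
    have h30 : Nat.totient 30 = 8 := by decide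
    rw [h30] at ht
    rw [← ht]
    refine Finset.card_le_card_of_injOn (fun k => p + k) ?_ (fun a _ b _ h => by simpa using h)
    intro k hk
    simp only [Finset.coe_filter, Finset.mem_range, Finset.mem_Ico, Set.mem_ofPred_eq] at hk ⊢
    refine ⟨⟨by omega, by omega⟩, ?_⟩
    rw [Nat.coprime_comm, Nat.Prime.coprime_iff_not_dvd hk.2]
    intro hd
    have := Nat.le_of_dvd (by norm_num) hd
    have h2 := hk.2
    have h7' : 7 ≤ p + k := by omega
    generalize p + k = q at *
    interval_cases q <;> revert hd h2 <;> norm_num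
  omega

/-- Iterating the gap bound gives slope `30 / 8 = 15 / 4`; the constant 29 is attained at `i = 7`,
where the prime is 19. -/
theorem Nat.fifteen_mul_le_nth_prime (i : ℕ) : 15 * i ≤ 4 * Nat.nth Nat.Prime i + 29 := by
  induction i using Nat.strong_induction_on with
  | _ i ih =>
    rcases lt_or_ge i 11 with hi | hi
    · suffices (15 * i - 26) / 4 ≤ Nat.nth Nat.Prime i by omega
      rw [← Nat.count_le_iff_le_nth Nat.infinite_setOfPred_prime]
      clear ih
      interval_cases i <;> norm_num [Nat.count_succ]
    · obtain ⟨j, rfl⟩ : ∃ j, i = j + 8 := ⟨i - 8, by omega⟩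
      have := Nat.nth_prime_add_thirty_le (i := j) (by omega)
      have := ih j (by omega)
      omega

theorem le_primeAvg {n : ℕ} (hn : 1 ≤ n) : 1.875 * n - 9.125 ≤ primeAvg n := by
  -- The left side is exactly the sum of `(15 i - 29) / 4` over `i < m`.
  have key : ∀ m : ℕ, (1.875 * m - 9.125) * (m : ℝ) ≤
      ∑ i ∈ Finset.range m, (Nat.nth Nat.Prime i : ℝ) := by
    intro m
    induction m with
    | zero => simp
    | succ m ih =>
      rw [Finset.sum_range_succ]
      have h : (15 * m : ℝ) ≤ 4 * (Nat.nth Nat.Prime m : ℝ) + 29 := by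
        exact_mod_cast Nat.fifteen_mul_le_nth_prime m
      push_cast
      nlinarith
  rw [primeAvg, le_div_iff₀ (by exact_mod_cast hn)]
  exact key n

theorem two_le_primeAvg {n : ℕ} (hn : 1 ≤ n) : 2 ≤ primeAvg n := by
  rw [primeAvg, le_div_iff₀ (by exact_mod_cast hn)]
  calc (2 : ℝ) * n = ∑ _i ∈ Finset.range n, (2 : ℝ) := by simp [mul_comm]
    _ ≤ _ := Finset.sum_le_sum fun i _ => by exact_mod_cast (Nat.prime_nth_prime i).two_le

theorem primeAvg_succ {n : ℕ} (hn : 1 ≤ n) :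
    primeAvg (n + 1) =
      primeAvg n + ((Nat.nth Nat.Prime n : ℝ) - primeAvg n) / (n + 1) := by
  have : (n : ℝ) ≠ 0 := by positivity
  simp only [primeAvg, Finset.sum_range_succ]
  push_cast
  field_simp
  ring

/-- If `p_{n+1} ≤ A (1 + log A)` for the average `A` of the first `n` primes, then the averages
satisfy the Firoozbakht inequality at `n`. -/
theorem primeAvg_succ_pow_lt_of_nth_le {n : ℕ} (hn : 1 ≤ n)
    (h : (Nat.nth Nat.Prime n : ℝ) ≤ primeAvg n * (1 + Real.log (primeAvg n))) :
    primeAvg (n + 1) ^ n < primeAvg n ^ (n + 1) := by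
  have hA := two_le_primeAvg hn
  have hA' := two_le_primeAvg (n := n + 1) (by omega)
  have hlog : 0 < Real.log (primeAvg n) := Real.log_pos (by linarith)
  have hn0 : (0 : ℝ) < n := by exact_mod_cast hn
  rw [← Real.log_lt_log_iff (by positivity) (by positivity), Real.log_pow, Real.log_pow]
  have hle : primeAvg (n + 1) / primeAvg n ≤ 1 + Real.log (primeAvg n) / (n + 1) := by
    rw [div_le_iff₀ (by positivity), primeAvg_succ hn, add_mul, one_mul, div_mul_eq_mul_div]
    gcongr
    linarith
  have h1 := Real.log_le_sub_one_of_pos (x := primeAvg (n + 1) / primeAvg n) (by positivity)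
  rw [Real.log_div (by positivity) (by positivity)] at h1
  have h2 : (n : ℝ) * (Real.log (primeAvg n) / (n + 1)) < Real.log (primeAvg n) := by
    rw [← mul_div_assoc, div_lt_iff₀ (by positivity)]
    linarith
  push_cast
  nlinarith [mul_le_mul_of_nonneg_left (h1.trans (sub_le_sub_right hle 1)) hn0.le]

/-- Trial division by the primes up to `31`. -/
def passesTrialDivision (q : ℕ) : Bool :=
  [2, 3, 5, 7, 11, 13, 17, 19, 23, 29, 31].all fun p => q % p != 0 || q == p

theorem passesTrialDivision_eq_true_iff {q : ℕ} (h2 : 2 ≤ q) (hq : q < 1024) :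
    passesTrialDivision q = true ↔ q.Prime := by
  simp only [passesTrialDivision, List.all_eq_true, Bool.or_eq_true, bne_iff_ne, beq_iff_eq, ne_eq,
    ← Nat.dvd_iff_mod_eq_zero, ← imp_iff_not_or]
  constructor
  · intro h
    by_contra hp
    have hm := Nat.minFac_sq_le_self (by omega) hp
    have hmp := Nat.minFac_prime (n := q) (by omega)
    have hd := Nat.minFac_dvd q
    have hmem : q.minFac ∈ [2, 3, 5, 7, 11, 13, 17, 19, 23, 29, 31] := by
      generalize q.minFac = m at *
      have : m < 32 := by nlinarith
      clear h hp hm hd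
      interval_cases m <;> revert hmp <;> norm_num
    rw [← h _ hmem hd] at hmp
    exact hp hmp
  · intro hp r hr hd
    refine (((Nat.dvd_prime hp).1 hd).resolve_left ?_).symm
    rintro rfl
    simp at hr

/-- Scans `q, q + 1, …, q + k - 1` for primes, where `n` and `S` are the number and the sum of the
primes below `q ≤ 1024 - k`, and tests the Firoozbakht inequality, cleared of denominators, at each. -/
def firoozbakhtCheck : ℕ → ℕ → ℕ → ℕ → Bool
  | 0, _, _, _ => true
  | k + 1, q, n, S =>
    if passesTrialDivision q then
      decide ((S + q) ^ n * n ^ (n + 1) < S ^ (n + 1) * (n + 1) ^ n) &&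
        firoozbakhtCheck k (q + 1) (n + 1) (S + q)
    else firoozbakhtCheck k (q + 1) n S

theorem firoozbakhtCheck_sound {k q c S n : ℕ} (hq2 : 2 ≤ q) (hqk : q + k ≤ 1024)
    (h : firoozbakhtCheck k q c S = true)
    (hc : Nat.count Nat.Prime q = c)
    (hS : ∑ i ∈ Finset.range c, Nat.nth Nat.Prime i = S)
    (h1 : q ≤ Nat.nth Nat.Prime n) (h2 : Nat.nth Nat.Prime n < q + k) :
    (∑ i ∈ Finset.range (n + 1), Nat.nth Nat.Prime i) ^ n * n ^ (n + 1) <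
      (∑ i ∈ Finset.range n, Nat.nth Nat.Prime i) ^ (n + 1) * (n + 1) ^ n := by
  induction k generalizing q c S with
  | zero => omega
  | succ k ih =>
    rw [firoozbakhtCheck] at h
    have hiff := passesTrialDivision_eq_true_iff hq2 (by omega)
    by_cases hq : q.Prime
    · rw [if_pos (hiff.2 hq), Bool.and_eq_true, decide_eq_true_eq] at h
      have hs : ∑ i ∈ Finset.range (c + 1), Nat.nth Nat.Prime i = S + q := by
        rw [Finset.sum_range_succ, hS, ← hc, Nat.nth_count hq]
      rcases h1.eq_or_lt with h1 | h1
      · have hn : c = n := by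
          rw [← hc, h1, Nat.count_nth_of_infinite Nat.infinite_setOfPred_prime]
        rw [← hn, hs, hS]
        exact h.1
      · exact ih (by omega) (by omega) h.2 (by rw [Nat.count_succ, hc, if_pos hq]) hs h1 (by omega)
    · have hne : q ≠ Nat.nth Nat.Prime n := fun h' => hq (h' ▸ Nat.prime_nth_prime n)
      rw [if_neg (hiff.not.2 hq)] at h
      exact ih (by omega) (by omega) h (by rw [Nat.count_succ, hc, if_neg hq, add_zero]) hS (lt_of_le_of_ne h1 hne) (by omega)

/-- The scan covers `3, …, 1023`, with the prime 2 already counted and summed: `n = 0` is excluded.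
-/
theorem firoozbakhtCheck_1021_3 : firoozbakhtCheck 1021 3 1 2 = true := by
  decide +kernel

theorem primeAvg_succ_pow_lt_of_nth_lt {n : ℕ} (hn : 1 ≤ n) (h : Nat.nth Nat.Prime n < 1024) :
    primeAvg (n + 1) ^ n < primeAvg n ^ (n + 1) := by
  have hc : Nat.count Nat.Prime 3 = 1 := by norm_num [Nat.count_succ]
  have h3 : 3 ≤ Nat.nth Nat.Prime n := by
    rw [← Nat.count_le_iff_le_nth Nat.infinite_setOfPred_prime, hc]
    exact hn
  have key := firoozbakhtCheck_sound (by norm_num) (by norm_num)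
    firoozbakhtCheck_1021_3 hc
    (by rw [Finset.sum_range_one, Nat.nth_prime_zero_eq_two]) h3 (by omega)
  have hn0 : (0 : ℝ) < n := by exact_mod_cast hn
  simp only [primeAvg, div_pow]
  rw [div_lt_div_iff₀ (by positivity) (by positivity)]
  exact_mod_cast key

/-- The Chebyshev lower bound for `π(x)` and the linear lower bound for the averages combine to
`x ≤ A (1 + log A)`. -/
theorem le_mul_one_add_log {x m A : ℝ} (hx : 1024 ≤ x)
    (hm : (x * Real.log 2 - Real.log (x + 1)) / Real.log x ≤ m + 1)
    (hA : 1.875 * m - 9.125 ≤ A) : x ≤ A * (1 + Real.log A) := by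
  have hl2 := Real.log_two_gt_d9
  have hl2' := Real.log_two_lt_d9
  have hx0 : 0 < x := by linarith
  set L := Real.log x with hL
  have h1024 : Real.log 1024 = 10 * Real.log 2 := by
    rw [show (1024 : ℝ) = 2 ^ 10 by norm_num, Real.log_pow]; norm_num
  have h8 : Real.log 8 = 3 * Real.log 2 := by
    rw [show (8 : ℝ) = 2 ^ 3 by norm_num, Real.log_pow]; norm_num
  have hL6 : 6.9 ≤ L := by
    have := Real.log_le_log (by norm_num) hx
    linarith
  -- Tangent line of `log` at 1024; the next bound uses the one at 8.
  have hLx : L ≤ 5.9315 + x / 1024 := by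
    have := Real.log_le_sub_one_of_pos (x := x / 1024) (by positivity)
    rw [Real.log_div (by positivity) (by norm_num)] at this
    linarith
  have hlogL : Real.log L ≤ 1.0795 + L / 8 := by
    have := Real.log_le_sub_one_of_pos (x := L / 8) (by positivity)
    rw [Real.log_div (by positivity) (by norm_num)] at this
    linarith
  have hx1 : Real.log (x + 1) ≤ L + 0.001 := by
    have := Real.log_le_sub_one_of_pos (x := (x + 1) / x) (by positivity)
    rw [Real.log_div (by positivity) (by positivity), add_div, div_self hx0.ne'] at this
    have : 1 / x ≤ 0.001 := by
      rw [div_le_iff₀ hx0]; linarith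
    linarith
  -- Since `1.875 * log 2 > 1.299`, lowering the factor to 1.2 absorbs the lower-order terms once `x
  -- ≥ 1024`.
  have hAx : 1.2 * (x / L) ≤ A := by
    rw [div_le_iff₀ (by linarith)] at hm
    rw [← mul_div_assoc, div_le_iff₀ (by linarith)]
    nlinarith
  -- Here `1 / 6 = 1 - 1 / 1.2` bounds `log 1.2` from below.
  have hlogA : 1 / 6 + L - Real.log L ≤ Real.log A := by
    have h1 := Real.log_le_log (by positivity) hAx
    rw [Real.log_mul (by norm_num) (by positivity),
      Real.log_div (by positivity) (by positivity)] at h1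
    have h2 := Real.one_sub_inv_le_log_of_pos (x := 1.2) (by norm_num)
    norm_num at h1 h2
    linarith
  calc x = x / L * L := by field_simp
    _ ≤ x / L * (1.2 * (1 + Real.log A)) := by gcongr; linarith
    _ = 1.2 * (x / L) * (1 + Real.log A) := by ring
    _ ≤ A * (1 + Real.log A) := by gcongr; linarith

theorem primeAvg_succ_pow_lt {n : ℕ} (hn : 1 ≤ n) :
    primeAvg (n + 1) ^ n < primeAvg n ^ (n + 1) := by
  rcases lt_or_ge (Nat.nth Nat.Prime n) 1024 with h | h
  · exact primeAvg_succ_pow_lt_of_nth_lt hn h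
  · refine primeAvg_succ_pow_lt_of_nth_le hn
      (le_mul_one_add_log (m := n) (by exact_mod_cast h) ?_ (le_primeAvg hn))
    have h1 := Chebyshev.pi_ge (Nat.nth Nat.Prime n)
    have h2 : Nat.primeCounting (Nat.nth Nat.Prime n) = n + 1 := by
      rw [Nat.primeCounting, Nat.primeCounting', Nat.count_succ,
        Nat.count_nth_of_infinite Nat.infinite_setOfPred_prime, if_pos (Nat.prime_nth_prime n)]
    rw [h2] at h1
    exact_mod_cast h1

theorem mainTheorem9 :
    StrictAntiOn (fun n : ℕ => primeAvg n ^ (1 / (n : ℝ))) (Set.Ici 1) ∧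
    ∀ n : ℕ, 1 ≤ n →
      (primeAvg (n + 1) ^ (1 / ((n : ℝ) + 1)) < primeAvg n ^ (1 / (n : ℝ)) ↔
        (Real.log (primeAvg (n + 1)) / Real.log (primeAvg n)) ^ n < (1 + 1 / (n : ℝ)) ^ n) ∧
      (Real.log (primeAvg (n + 1)) / Real.log (primeAvg n)) ^ n < (1 + 1 / (n : ℝ)) ^ n ∧
      (Real.log (primeAvg (n + 1)) / Real.log (primeAvg n)) ^ n < Real.exp 1 := by
  have hiff : ∀ n : ℕ, 1 ≤ n →
      (primeAvg (n + 1) ^ (1 / ((n : ℝ) + 1)) < primeAvg n ^ (1 / (n : ℝ)) ↔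
        (Real.log (primeAvg (n + 1)) / Real.log (primeAvg n)) ^ n < (1 + 1 / (n : ℝ)) ^ n) := by
    intro n hn
    have hn0 : (0 : ℝ) < n := by exact_mod_cast hn
    have hA := two_le_primeAvg hn
    have hA' := two_le_primeAvg (n := n + 1) (by omega)
    have hlog : 0 < Real.log (primeAvg n) := Real.log_pos (by linarith)
    have hlog' : 0 < Real.log (primeAvg (n + 1)) := Real.log_pos (by linarith)
    rw [pow_lt_pow_iff_left₀ (by positivity) (by positivity) (by omega),
      ← Real.log_lt_log_iff (by positivity) (by positivity), Real.log_rpow (by positivity),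
      Real.log_rpow (by positivity), div_lt_iff₀ hlog, div_mul_eq_mul_div, div_mul_eq_mul_div,
      div_lt_div_iff₀ (by positivity) hn0, one_add_div hn0.ne', div_mul_eq_mul_div,
      lt_div_iff₀ hn0, one_mul, one_mul, mul_comm (Real.log (primeAvg n))]
  have hlt : ∀ n : ℕ, 1 ≤ n →
      primeAvg (n + 1) ^ (1 / ((n : ℝ) + 1)) < primeAvg n ^ (1 / (n : ℝ)) := by
    intro n hn
    have hn0 : (0 : ℝ) < n := by exact_mod_cast hn
    have hA := two_le_primeAvg hn
    have hA' := two_le_primeAvg (n := n + 1) (by omega)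
    have h := primeAvg_succ_pow_lt hn
    rw [← Real.log_lt_log_iff (by positivity) (by positivity), Real.log_pow, Real.log_pow] at h
    rw [← Real.log_lt_log_iff (by positivity) (by positivity), Real.log_rpow (by positivity),
      Real.log_rpow (by positivity), div_mul_eq_mul_div, div_mul_eq_mul_div,
      div_lt_div_iff₀ (by positivity) hn0]
    push_cast at h
    linarith
  refine ⟨?_, fun n hn => ⟨hiff n hn, (hiff n hn).1 (hlt n hn),
    ((hiff n hn).1 (hlt n hn)).trans ?_⟩⟩
  · have hanti : StrictAnti fun n : ℕ => primeAvg (n + 1) ^ (1 / ((n + 1 : ℕ) : ℝ)) := by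
      refine strictAnti_nat_of_succ_lt fun n => ?_
      have := hlt (n + 1) (by omega)
      push_cast at this ⊢
      exact this
    intro a ha b hb hab
    obtain ⟨a, rfl⟩ := Nat.exists_eq_add_of_le' (Set.mem_Ici.1 ha)
    obtain ⟨b, rfl⟩ := Nat.exists_eq_add_of_le' (Set.mem_Ici.1 hb)
    exact hanti (by omega)
  · have hn0 : (0 : ℝ) < n := by exact_mod_cast hn
    calc (1 + 1 / (n : ℝ)) ^ n < Real.exp (1 / (n : ℝ)) ^ n := by
          refine pow_lt_pow_left₀ ?_ (by positivity) (by omega)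
          rw [add_comm]
          exact Real.add_one_lt_exp (by positivity)
      _ = Real.exp 1 := by rw [← Real.exp_nat_mul, mul_one_div_cancel hn0.ne']
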